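/- Let $1\le p<\infty$, and let $(X,d)$ be a connected, proper metric space with a Borel-regular measure $\mu$ such that $\mu(X)=\infty$ and $0<\mu(B(x,r))<\infty$ for all $x\in X$ and $r\in(0,\infty)$. A Borel function $g:X\to[0,\infty]$ is an upper gradient of $u:X\to\mathbb R$ if $|u(x)-u(y)|\le\int_\gamma g\,ds$ for every compact rectifiable curve $\gamma$ with endpoints $x,y$. The class $D^{1,p}(X)$ consists of the $\mu$-measurable functions $u:X\to\mathbb R$ that have an upper gradient $g$ with $\int_X g^p\,d\mu<\infty$, and $N^{1,p}(X)=\{u\in D^{1,p}(X):\int_X|u|^p\,d\mu<\infty\}$. The $p$-modulus of a family $\Gamma$ of locally rectifiable curves is $\mathrm{Mod}_p(\Gamma)=\inf_\rho\int_X\rho^p\,d\mu$, where $\rho$ ranges over the Borel functions $\rho:X\to[0,\infty]$ with $\int_\gamma\rho\,ds\ge1$ for all $\gamma\in\Gamma$. A set $K\subset X$ is $p$-exceptional if the family of non-constant locally rectifiable curves that meet $K$ has zero $p$-modulus. An end at infinity of $X$ is a sequence $(F_j)_{j\ge1}$ of subsets of $X$, with associated compact sets $K_j\subset X$, such that each $F_j$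 is an unbounded connected component of $X\setminus K_j$, $\overline{F_{j+1}}\subset F_j$ and $\mathrm{dist}(X\setminus F_j,F_{j+1})>0$ for all $j$, and $\bigcap_jF_j=\emptyset$. Let $\Gamma_j$ be the family of locally rectifiable curves $\gamma:[0,\infty)\to X$ with $\gamma(0)\in K_1$ and $\gamma((\tau,\infty))\subset F_j$ for some $\tau>0$. The end is $p$-hyperbolic if $\lim_{j\to\infty}\mathrm{Mod}_p(\Gamma_j)>0$, and $p$-parabolic otherwise. Suppose that $X$ is of uniformly locally $p$-controlled geometry: there are $0<R_0\le\infty$, $C_d\ge1$ and $C,\lambda>0$ such that for all $x\in X$ and $0<r<R_0$ we have $\mu(B(x,2r))\le C_d\,\mu(B(x,r))$, and $$\frac1{\mu(B(x,r))}\int_{B(x,r)}|u-u_{B(x,r)}|\,d\mu\le C\,r\left(\frac1{\mu(B(x,\lambda r))}\int_{B(x,\lambda r)}g^p\,d\mu\right)^{1/p}$$ for every $u\in L^1_{\mathrm{loc}}(X)$ and every upper gradient $g$ of $u$, where $u_{B(x,r)}$ is the mean of $u$ over $B(x,r)$. Suppose also that $X$ is a length space and that $\inf_{x\in X}\mu(B(x,1))>0$.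 If $X$ has a $p$-parabolic end $(F_j)_j$ whose associated compact set $K_1$ is not $p$-exceptional, then $D^{1,p}(X)\ne N^{1,p}(X)+\mathbb R$, where $\mathbb R$ denotes the constant functions. -/

import Mathlib

open Set Filter Topology MeasureTheory
open scoped ENNReal NNReal Pointwise

noncomputable section

namespace NewtonSobolev

variable {X : Type*} [MetricSpace X]

/-- `γ` restricted to `[a, b]` is a compact rectifiable curve. -/
structure IsRectifiableCurve (γ : ℝ → X) (a b : ℝ) : Prop where
  le : a ≤ b
  continuousOn : ContinuousOn γ (Icc a b)
  rectifiable : BoundedVariationOn γ (Icc a b)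

/-- `∫_γ ρ ds` along `γ : [a, b] → X`: the integral over `[0, ℓ(γ)]` of `ρ` composed with the
arc-length parametrization of `γ`. -/
def lineIntegral (ρ : X → ℝ≥0∞) (γ : ℝ → X) (a b : ℝ) : ℝ≥0∞ :=
  ∫⁻ t in Icc 0 (eVariationOn γ (Icc a b)).toReal, ρ (naturalParameterization γ (Icc a b) a t)

/-- `γ` restricted to `[0, ∞)` is a locally rectifiable curve. Compact rectifiable curves are
included, as the curves that are eventually constant. -/
structure IsLocallyRectifiableRay (γ : ℝ → X) : Prop where
  continuousOn : ContinuousOn γ (Ici 0)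
  rectifiable : LocallyBoundedVariationOn γ (Ici 0)

/-- `∫_γ ρ ds` along a locally rectifiable `γ : [0, ∞) → X`: the supremum of the integrals over
compact subcurves. -/
def rayIntegral (ρ : X → ℝ≥0∞) (γ : ℝ → X) : ℝ≥0∞ :=
  ⨆ T : ℝ≥0, lineIntegral ρ γ 0 T

/-- Every two points are joined by curves of length arbitrarily close to their distance. -/
def IsLengthSpace (X : Type*) [MetricSpace X] : Prop :=
  ∀ x y : X, ∀ ε : ℝ, 0 < ε → ∃ γ : ℝ → X,
    ContinuousOn γ (Icc 0 1) ∧ γ 0 = x ∧ γ 1 = y ∧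
      eVariationOn γ (Icc 0 1) ≤ ENNReal.ofReal (dist x y + ε)

variable [MeasurableSpace X]

/-- `g` is an upper gradient of `u`. (Constant curves impose no condition.) -/
def IsUpperGradient (u : X → ℝ) (g : X → ℝ≥0∞) : Prop :=
  Measurable g ∧ ∀ (γ : ℝ → X) (a b : ℝ), IsRectifiableCurve γ a b →
    ‖u (γ b) - u (γ a)‖ₑ ≤ lineIntegral g γ a b

/-- The Dirichlet class `D^{1,p}(X)`, of pointwise defined functions that are measurable with
respect to the completion of `μ`. -/
def dirichletClass (μ : Measure X) (p : ℝ) : Set (X → ℝ) :=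
  {u | AEMeasurable u μ ∧ ∃ g : X → ℝ≥0∞, IsUpperGradient u g ∧ ∫⁻ x, g x ^ p ∂μ < ∞}

/-- The Newton-Sobolev class `N^{1,p}(X)`. -/
def newtonClass (μ : Measure X) (p : ℝ) : Set (X → ℝ) :=
  {u | u ∈ dirichletClass μ p ∧ ∫⁻ x, ‖u x‖ₑ ^ p ∂μ < ∞}

/-- Uniformly local doubling together with a uniformly local `p`-Poincaré inequality. -/
def UniformlyLocallyControlled (μ : Measure X) (p : ℝ) : Prop :=
  ∃ (R₀ : ℝ≥0∞) (Cd : ℝ≥0) (C lam : ℝ), 0 < R₀ ∧ 1 ≤ Cd ∧ 0 < C ∧ 0 < lam ∧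
    ∀ (x : X) (r : ℝ), 0 < r → ENNReal.ofReal r < R₀ →
      μ (Metric.ball x (2 * r)) ≤ Cd * μ (Metric.ball x r) ∧
      ∀ (u : X → ℝ) (g : X → ℝ≥0∞), LocallyIntegrable u μ → IsUpperGradient u g →
        ⨍⁻ y in Metric.ball x r, ‖u y - ⨍ z in Metric.ball x r, u z ∂μ‖ₑ ∂μ ≤
          ENNReal.ofReal (C * r) * (⨍⁻ y in Metric.ball x (lam * r), g y ^ p ∂μ) ^ (1 / p)

/-- The `p`-modulus of a family of locally rectifiable curves `[0, ∞) → X`. -/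
def modulus (μ : Measure X) (p : ℝ) (Γ : Set (ℝ → X)) : ℝ≥0∞ :=
  ⨅ (ρ : X → ℝ≥0∞) (_ : Measurable ρ) (_ : ∀ γ ∈ Γ, 1 ≤ rayIntegral ρ γ), ∫⁻ x, ρ x ^ p ∂μ

/-- `K` is `p`-exceptional: `p`-almost no non-constant curve meets it. -/
def IsExceptional (μ : Measure X) (p : ℝ) (K : Set X) : Prop :=
  modulus μ p {γ | IsLocallyRectifiableRay γ ∧ (γ '' Ici 0).Nontrivial ∧
    ((γ '' Ici 0) ∩ K).Nonempty} = 0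

/-- `F` is an end at infinity, with associated compact sets `K`. The second condition says
`dist (X \ F j, F (j + 1)) > 0`. -/
structure IsEnd (F K : ℕ → Set X) : Prop where
  closure_subset : ∀ j, closure (F (j + 1)) ⊆ F j
  separated : ∀ j, ∃ δ : ℝ, 0 < δ ∧ ∀ x ∉ F j, ∀ y ∈ F (j + 1), δ ≤ dist x y
  iInter_eq : ⋂ j, F j = ∅
  isCompact : ∀ j, IsCompact (K j)
  component : ∀ j, ∃ x ∈ (K j)ᶜ, F j = connectedComponentIn (K j)ᶜ x
  unbounded : ∀ j, ¬ Bornology.IsBounded (F j)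

/-- The locally rectifiable curves that start in `K` and are eventually in `F`. -/
def curvesToward (K F : Set X) : Set (ℝ → X) :=
  {γ | IsLocallyRectifiableRay γ ∧ γ 0 ∈ K ∧ ∃ τ : ℝ, 0 < τ ∧ γ '' Ioi τ ⊆ F}

/-- The end `F`, with associated compact sets `K`, is `p`-hyperbolic. -/
def IsHyperbolicEnd (μ : Measure X) (p : ℝ) (F K : ℕ → Set X) : Prop :=
  ∃ L : ℝ≥0∞, 0 < L ∧ Tendsto (fun j => modulus μ p (curvesToward (K 0) (F j))) atTop (𝓝 L)

/-- The end `F`, with associated compact sets `K`, is `p`-parabolic. -/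
def IsParabolicEnd (μ : Measure X) (p : ℝ) (F K : ℕ → Set X) : Prop :=
  ¬ IsHyperbolicEnd μ p F K

end NewtonSobolev

end

/-! Parabolicity makes the end infinitely far from `K 0` in a conformally weighted sense. Summing
p-th powers of rescaled nearly optimal densities gives an L^p density σ, lower semicontinuous by
Vitali–Carathéodory, such that curves from `K 0` toward `F k` have σ-length at least 2^j once k is
large (`exists_weight_of_isParabolicEnd`).

The function sought is U, the σ-distance from `K 0` (`potential`). It has σ as upper gradient, is
measurable by Arzelà–Ascoli and Fatou (`measurable_potential`), and is at least 2^j on some `F k`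
(`le_potential`).

U must also be finite almost everywhere. No curve of finite σ-length crosses between {U = ∞} and its
complement, so every εσ is an upper gradient of the indicator of {U = ∞}. Letting ε → 0 in the
Poincaré inequality, and using connectedness, this set is null or conull. If it were conull, curves
meeting `K 0` would have infinite σ-length or run inside a null set, making `K 0` exceptional.

Finally, if U = v + c with v in N^{1,p}, then |v| ≥ 1 a.e. on some `F k`. But `F k` contains
infinitely many disjoint unit balls, so its measure is infinite (`measure_unbounded_component`),
contradicting v ∈ L^p. -/

namespace NewtonSobolev

/-! ### Weighted distances and line integrals. Lipschitz parametrizations, unlike arc-length ones,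
are stable under uniform limits. -/

section Curves

variable {X : Type*} [MetricSpace X]

/-- The costs `∫ σ (c t) dt` of the `1`-Lipschitz curves `c : [0, L] → X` from `x` to `y`. -/
def curveCosts (σ : X → ℝ≥0∞) (x y : X) : Set ℝ≥0∞ :=
  {J | ∃ (L : ℝ) (c : ℝ → X), 0 ≤ L ∧ LipschitzOnWith 1 c (Icc 0 L) ∧ c 0 = x ∧ c L = y ∧
    ∫⁻ t in Icc 0 L, σ (c t) = J}

/-- The pseudodistance with density `σ`. -/
noncomputable def weightedDist (σ : X → ℝ≥0∞) (x y : X) : ℝ≥0∞ :=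
  sInf (curveCosts σ x y)

theorem setLIntegral_Icc_comp_const_sub (f : ℝ → ℝ≥0∞) (L a b : ℝ) :
    ∫⁻ t in Icc a b, f (L - t) = ∫⁻ t in Icc (L - b) (L - a), f t := by
  have h := (volume.measurePreserving_sub_left L).setLIntegral_comp_emb
    (MeasurableEquiv.subLeft L).measurableEmbedding f (Icc a b)
  simpa using h

theorem setLIntegral_Icc_comp_sub_const (f : ℝ → ℝ≥0∞) (L a b : ℝ) :
    ∫⁻ t in Icc a b, f (t - L) = ∫⁻ t in Icc (a - L) (b - L), f t := by
  have h := (measurePreserving_sub_right volume L).setLIntegral_comp_emb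
    (MeasurableEquiv.subRight L).measurableEmbedding f (Icc a b)
  simpa using h

theorem weightedDist_self (σ : X → ℝ≥0∞) (x : X) : weightedDist σ x x = 0 := by
  refine le_antisymm (sInf_le ⟨0, fun _ => x, le_rfl, ?_, rfl, rfl, by simp⟩) bot_le
  exact (LipschitzWith.const' x).lipschitzOnWith

theorem curveCosts_comm (σ : X → ℝ≥0∞) (x y : X) : curveCosts σ x y ⊆ curveCosts σ y x := by
  rintro J ⟨L, c, hL, hc, rfl, rfl, rfl⟩
  refine ⟨L, fun t => c (L - t), hL, ?_, by simp, by simp, ?_⟩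
  · intro s hs t ht
    have := hc (x := L - s) ⟨by linarith [hs.2], by linarith [hs.1]⟩
      (y := L - t) ⟨by linarith [ht.2], by linarith [ht.1]⟩
    simpa using this
  · simpa using setLIntegral_Icc_comp_const_sub (fun t => σ (c t)) L 0 L

theorem weightedDist_comm (σ : X → ℝ≥0∞) (x y : X) : weightedDist σ x y = weightedDist σ y x :=
  le_antisymm (sInf_le_sInf (curveCosts_comm σ y x)) (sInf_le_sInf (curveCosts_comm σ x y))

theorem weightedDist_triangle (σ : X → ℝ≥0∞) (x y z : X) :
    weightedDist σ x z ≤ weightedDist σ x y + weightedDist σ y z := by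
  simp only [weightedDist, ENNReal.sInf_add, ENNReal.add_sInf]
  refine le_iInf₂ fun J hJ => le_iInf₂ fun I hI => ?_
  obtain ⟨L, c, hL, hc, rfl, rfl, rfl⟩ := hI
  obtain ⟨M, d, hM, hd, hd0, rfl, rfl⟩ := hJ
  set e : ℝ → X := fun t => if t ≤ L then c t else d (t - L) with he
  have e1 : ∀ t ≤ L, e t = c t := fun t ht => by simp [he, ht]
  have e2 : ∀ t, L ≤ t → e t = d (t - L) := fun t ht => by
    rcases ht.eq_or_lt with rfl | ht
    · simp [he, hd0]
    · simp [he, ht.not_ge]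
  have hlip : ∀ s ∈ Icc 0 (L + M), ∀ t ∈ Icc 0 (L + M), s ≤ t → dist (e s) (e t) ≤ t - s := by
    intro s hs t ht hst
    have dc : ∀ s ∈ Icc 0 L, ∀ t ∈ Icc 0 L, s ≤ t → dist (c s) (c t) ≤ t - s := by
      intro s hs t ht hst
      simpa [Real.dist_eq, abs_sub_comm s t, abs_of_nonneg (sub_nonneg.2 hst)]
        using hc.dist_le_mul s hs t ht
    have dd : ∀ s ∈ Icc 0 M, ∀ t ∈ Icc 0 M, s ≤ t → dist (d s) (d t) ≤ t - s := by
      intro s hs t ht hst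
      simpa [Real.dist_eq, abs_sub_comm s t, abs_of_nonneg (sub_nonneg.2 hst)]
        using hd.dist_le_mul s hs t ht
    rcases le_total t L with htL | htL
    · rw [e1 s (hst.trans htL), e1 t htL]
      exact dc s ⟨hs.1, hst.trans htL⟩ t ⟨ht.1, htL⟩ hst
    · rcases le_total s L with hsL | hsL
      · have h1 := dc s ⟨hs.1, hsL⟩ L ⟨hL, le_rfl⟩ hsL
        have h2 := dd 0 ⟨le_rfl, hM⟩ (t - L) ⟨by linarith, by linarith [ht.2]⟩ (by linarith)
        rw [e1 s hsL, e2 t htL]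
        rw [hd0] at h2
        linarith [dist_triangle (c s) (c L) (d (t - L))]
      · rw [e2 s hsL, e2 t htL]
        have := dd (s - L) ⟨by linarith, by linarith [hs.2]⟩ (t - L)
          ⟨by linarith, by linarith [ht.2]⟩ (by linarith)
        linarith
  calc sInf (curveCosts σ (c 0) (d M)) ≤ ∫⁻ t in Icc 0 (L + M), σ (e t) := by
        refine sInf_le ⟨L + M, e, by positivity, ?_, e1 0 hL, ?_, rfl⟩
        · refine LipschitzOnWith.of_dist_le_mul fun s hs t ht => ?_
          rw [NNReal.coe_one, one_mul, Real.dist_eq]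
          rcases le_total s t with h | h
          · rw [abs_sub_comm, abs_of_nonneg (sub_nonneg.2 h)]
            exact hlip s hs t ht h
          · rw [abs_of_nonneg (sub_nonneg.2 h), dist_comm]
            exact hlip t ht s hs h
        · rw [e2 _ (by linarith)]; simp
    _ ≤ (∫⁻ t in Icc 0 L, σ (e t)) + ∫⁻ t in Icc L (L + M), σ (e t) := by
        rw [← Icc_union_Icc_eq_Icc hL (by linarith : L ≤ L + M)]
        exact lintegral_union_le _ _ _
    _ = (∫⁻ t in Icc 0 L, σ (c t)) + ∫⁻ t in Icc 0 M, σ (d t) := by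
        congr 1
        · exact setLIntegral_congr_fun measurableSet_Icc fun t ht => by simp only [e1 t ht.2]
        · rw [setLIntegral_congr_fun (g := fun t => σ (d (t - L))) measurableSet_Icc
            fun t ht => by simp only [e2 t ht.1]]
          simpa using setLIntegral_Icc_comp_sub_const (fun t => σ (d t)) L L (L + M)

theorem weightedDist_le_setLIntegral (σ : X → ℝ≥0∞) {c : ℝ → X} {V s t : ℝ}
    (hc : LipschitzOnWith 1 c (Icc 0 V)) (hs : s ∈ Icc 0 V) (ht : t ∈ Icc 0 V) :
    weightedDist σ (c s) (c t) ≤ ∫⁻ r in Icc 0 V, σ (c r) := by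
  wlog hst : s ≤ t generalizing s t
  · rw [weightedDist_comm]
    exact this ht hs (le_of_not_ge hst)
  calc weightedDist σ (c s) (c t) ≤ ∫⁻ r in Icc 0 (t - s), σ (c (r - -s)) := by
        refine sInf_le ⟨t - s, fun r => c (r - -s), by linarith, ?_, by simp, by simp, rfl⟩
        intro x hx y hy
        have := hc (x := x - -s) ⟨by linarith [hx.1, hs.1], by linarith [hx.2, ht.2]⟩
          (y := y - -s) ⟨by linarith [hy.1, hs.1], by linarith [hy.2, ht.2]⟩
        simpa using this
    _ = ∫⁻ r in Icc s t, σ (c r) := by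
        simpa using setLIntegral_Icc_comp_sub_const (fun r => σ (c r)) (-s) 0 (t - s)
    _ ≤ _ := lintegral_mono_set (Icc_subset_Icc hs.1 ht.2)

/-- The arc-length function can jump only where γ does. Continuity makes it attain every value in
[0, ℓ(γ)]. -/
theorem continuousOn_variationOnFromTo {γ : ℝ → X} {a b : ℝ} (h : IsRectifiableCurve γ a b) :
    ContinuousOn (variationOnFromTo γ (Icc a b) a) (Icc a b) := by
  intro t ht
  have ha : a ∈ Icc a b := ⟨le_rfl, h.le⟩
  have hlb := h.rectifiable.locallyBoundedVariationOn
  have hc := h.continuousOn t ht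
  have hl := variationOnFromTo.tendsto_left ha ht hlb
    (hc.mono_left (nhdsWithin_mono _ inter_subset_left))
  have hr := variationOnFromTo.tendsto_right ha ht hlb
    (hc.mono_left (nhdsWithin_mono _ inter_subset_left))
  simp only [dist_self, sub_zero, add_zero] at hl hr
  have h1 : ContinuousWithinAt (variationOnFromTo γ (Icc a b) a) (Icc a b ∩ Iio t) t := hl
  have h2 : ContinuousWithinAt (variationOnFromTo γ (Icc a b) a) (Icc a b ∩ Ioi t) t := hr
  refine ((h1.union h2).insert).mono fun s hs => ?_
  rcases lt_trichotomy s t with hst | rfl | hst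
  · exact Or.inr (Or.inl ⟨hs, hst⟩)
  · exact Or.inl rfl
  · exact Or.inr (Or.inr ⟨hs, hst⟩)

theorem variationOnFromTo_right {γ : ℝ → X} {a b : ℝ} (hab : a ≤ b) :
    variationOnFromTo γ (Icc a b) a b = (eVariationOn γ (Icc a b)).toReal := by
  rw [variationOnFromTo.eq_of_le _ _ hab, inter_self]

theorem image_variationOnFromTo {γ : ℝ → X} {a b : ℝ} (h : IsRectifiableCurve γ a b) :
    variationOnFromTo γ (Icc a b) a '' Icc a b = Icc 0 (eVariationOn γ (Icc a b)).toReal := by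
  have ha : a ∈ Icc a b := ⟨le_rfl, h.le⟩
  have hb : b ∈ Icc a b := ⟨h.le, le_rfl⟩
  have hm := variationOnFromTo.monotoneOn h.rectifiable.locallyBoundedVariationOn ha
  refine Subset.antisymm ?_ ?_
  · rintro _ ⟨t, ht, rfl⟩
    refine ⟨variationOnFromTo.nonneg_of_le _ _ ht.1, ?_⟩
    rw [← variationOnFromTo_right h.le]
    exact hm ht hb ht.2
  · have := intermediate_value_Icc h.le (continuousOn_variationOnFromTo h)
    rwa [variationOnFromTo.self, variationOnFromTo_right h.le] at this

theorem lipschitzOnWith_naturalParameterization {γ : ℝ → X} {a b : ℝ}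
    (h : IsRectifiableCurve γ a b) :
    LipschitzOnWith 1 (naturalParameterization γ (Icc a b) a)
      (Icc 0 (eVariationOn γ (Icc a b)).toReal) := by
  have hu := has_unit_speed_naturalParameterization γ h.rectifiable.locallyBoundedVariationOn
    (a := a) ⟨le_rfl, h.le⟩
  rw [image_variationOnFromTo h] at hu
  have key : ∀ s ∈ Icc 0 (eVariationOn γ (Icc a b)).toReal,
      ∀ t ∈ Icc 0 (eVariationOn γ (Icc a b)).toReal, s ≤ t →
      edist (naturalParameterization γ (Icc a b) a s) (naturalParameterization γ (Icc a b) a t)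
        ≤ edist s t := by
    intro s hs t ht hst
    refine (eVariationOn.edist_le _ (s := Icc 0 (eVariationOn γ (Icc a b)).toReal ∩ Icc s t)
      ⟨hs, le_rfl, hst⟩ ⟨ht, hst, le_rfl⟩).trans ?_
    rw [hu hs ht, edist_comm, edist_dist, Real.dist_eq, abs_of_nonneg (sub_nonneg.2 hst)]
    simp
  intro s hs t ht
  rw [ENNReal.coe_one, one_mul]
  rcases le_total s t with hst | hst
  · exact key s hs t ht hst
  · rw [edist_comm, edist_comm s]
    exact key t ht s hs hst

theorem naturalParameterization_variationOnFromTo {γ : ℝ → X} {a b t : ℝ}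
    (h : IsRectifiableCurve γ a b) (ht : t ∈ Icc a b) :
    naturalParameterization γ (Icc a b) a (variationOnFromTo γ (Icc a b) a t) = γ t :=
  edist_eq_zero.1 <| edist_naturalParameterization_eq_zero
    h.rectifiable.locallyBoundedVariationOn ⟨le_rfl, h.le⟩ ht

theorem weightedDist_naturalParameterization_le (σ : X → ℝ≥0∞) {γ : ℝ → X} {a b s t : ℝ}
    (h : IsRectifiableCurve γ a b) (hs : s ∈ Icc a b)
    (ht : t ∈ Icc 0 (eVariationOn γ (Icc a b)).toReal) :
    weightedDist σ (γ s) (naturalParameterization γ (Icc a b) a t) ≤ lineIntegral σ γ a b := by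
  have hs' : variationOnFromTo γ (Icc a b) a s ∈ Icc 0 (eVariationOn γ (Icc a b)).toReal :=
    image_variationOnFromTo h ▸ mem_image_of_mem _ hs
  rw [← naturalParameterization_variationOnFromTo h hs]
  exact weightedDist_le_setLIntegral σ (lipschitzOnWith_naturalParameterization h) hs' ht

theorem weightedDist_le_lineIntegral (σ : X → ℝ≥0∞) {γ : ℝ → X} {a b : ℝ}
    (h : IsRectifiableCurve γ a b) :
    weightedDist σ (γ a) (γ b) ≤ lineIntegral σ γ a b := by
  have hb : b ∈ Icc a b := ⟨h.le, le_rfl⟩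
  rw [← naturalParameterization_variationOnFromTo h hb]
  refine weightedDist_naturalParameterization_le σ h ⟨le_rfl, h.le⟩ ?_
  exact image_variationOnFromTo h ▸ mem_image_of_mem _ hb

theorem isRectifiableCurve_of_lipschitzOnWith {γ : ℝ → X} {a b : ℝ} (hab : a ≤ b)
    (hγ : LipschitzOnWith 1 γ (Icc a b)) : IsRectifiableCurve γ a b := by
  refine ⟨hab, hγ.continuousOn, ?_⟩
  have := hγ.locallyBoundedVariationOn a b ⟨le_rfl, hab⟩ ⟨hab, le_rfl⟩
  rwa [inter_self] at this

theorem lipschitzOnWith_variationOnFromTo {γ : ℝ → X} {a b : ℝ} (hab : a ≤ b)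
    (hγ : LipschitzOnWith 1 γ (Icc a b)) :
    LipschitzOnWith 1 (variationOnFromTo γ (Icc a b) a) (Icc a b) := by
  have h := isRectifiableCurve_of_lipschitzOnWith hab hγ
  have hlb := h.rectifiable.locallyBoundedVariationOn
  have key : ∀ s ∈ Icc a b, ∀ t ∈ Icc a b, s ≤ t →
      dist (variationOnFromTo γ (Icc a b) a t) (variationOnFromTo γ (Icc a b) a s) ≤ t - s := by
    intro s hs t ht hst
    rw [Real.dist_eq, variationOnFromTo.sub_right hlb ⟨le_rfl, hab⟩ ht hs,
      abs_of_nonneg (variationOnFromTo.nonneg_of_le _ _ hst), variationOnFromTo.eq_of_le _ _ hst]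
    have h1 : eVariationOn (γ ∘ id) (Icc a b ∩ Icc s t) ≤
        (1 : ℝ≥0) * eVariationOn (id : ℝ → ℝ) (Icc a b ∩ Icc s t) :=
      hγ.comp_eVariationOn_le fun x hx => hx.1
    have h2 := eVariationOn.mono (id : ℝ → ℝ) (inter_subset_right : Icc a b ∩ Icc s t ⊆ Icc s t)
    rw [eVariationOn_id_Icc] at h2
    rw [ENNReal.coe_one, one_mul] at h1
    exact ENNReal.toReal_le_of_le_ofReal (sub_nonneg.2 hst) (h1.trans h2)
  refine LipschitzOnWith.of_dist_le_mul fun s hs t ht => ?_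
  rw [NNReal.coe_one, one_mul, Real.dist_eq s t]
  rcases le_total s t with hst | hst
  · rw [dist_comm, abs_sub_comm, abs_of_nonneg (sub_nonneg.2 hst)]
    exact key s hs t ht hst
  · rw [abs_of_nonneg (sub_nonneg.2 hst)]
    exact key t ht s hs hst

/-- The line integral is at most the integral over the parameter of a `1`-Lipschitz curve. -/
theorem lineIntegral_le_setLIntegral (σ : X → ℝ≥0∞) {γ : ℝ → X} {a b : ℝ} (hab : a ≤ b)
    (hγ : LipschitzOnWith 1 γ (Icc a b)) :
    lineIntegral σ γ a b ≤ ∫⁻ t in Icc a b, σ (γ t) := by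
  have h := isRectifiableCurve_of_lipschitzOnWith hab hγ
  have hs := lipschitzOnWith_variationOnFromTo hab hγ
  set s := variationOnFromTo γ (Icc a b) a with hsdef
  -- The arc-length function s is 1-Lipschitz, so it does not increase Lebesgue measure. Hence
  -- Lebesgue measure on [0, ℓ] is at most the push-forward by s, and σ needs no measurability.
  have hmeas : AEMeasurable s (volume.restrict (Icc a b)) :=
    hs.continuousOn.aemeasurable measurableSet_Icc
  have hle : volume.restrict (Icc 0 (eVariationOn γ (Icc a b)).toReal) ≤
      (volume.restrict (Icc a b)).map s := by
    refine Measure.le_iff.2 fun A hA => ?_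
    rw [Measure.restrict_apply hA, Measure.map_apply_of_aemeasurable hmeas hA,
      Measure.restrict_apply₀' measurableSet_Icc.nullMeasurableSet]
    have hsub : A ∩ Icc 0 (eVariationOn γ (Icc a b)).toReal ⊆ s '' (s ⁻¹' A ∩ Icc a b) := by
      rintro y ⟨hyA, hy⟩
      rw [← image_variationOnFromTo h] at hy
      obtain ⟨t, ht, rfl⟩ := hy
      exact ⟨t, ⟨hyA, ht⟩, rfl⟩
    refine (measure_mono hsub).trans ?_
    have := (hs.mono (inter_subset_right : s ⁻¹' A ∩ Icc a b ⊆ Icc a b)).hausdorffMeasure_image_le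
      (d := 1) zero_le_one
    simpa [hausdorffMeasure_real] using this
  calc lineIntegral σ γ a b
      ≤ ∫⁻ t, σ (naturalParameterization γ (Icc a b) a t) ∂(volume.restrict (Icc a b)).map s :=
        lintegral_mono' hle le_rfl
    _ ≤ ∫⁻ t in Icc a b, σ (naturalParameterization γ (Icc a b) a (s t)) :=
        lintegral_map_le _ _
    _ = ∫⁻ t in Icc a b, σ (γ t) := setLIntegral_congr_fun measurableSet_Icc fun t ht => by
        simp only [hsdef, naturalParameterization_variationOnFromTo h ht]

/-- A constant tail adds no length, so a compact curve can be continued to a ray at no cost. -/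
theorem lineIntegral_eq_of_eqOn_const (σ : X → ℝ≥0∞) {γ : ℝ → X} {a b c : ℝ}
    (h : IsRectifiableCurve γ a c) (hab : a ≤ b) (hbc : b ≤ c) (hconst : ∀ t ∈ Icc b c, γ t = γ b) :
    lineIntegral σ γ a c = lineIntegral σ γ a b := by
  have hsub : Icc a b ⊆ Icc a c := Icc_subset_Icc_right hbc
  have h' : IsRectifiableCurve γ a b :=
    ⟨hab, h.continuousOn.mono hsub, h.rectifiable.mono hsub⟩
  have hV : eVariationOn γ (Icc a c) = eVariationOn γ (Icc a b) := by
    have h1 := eVariationOn.Icc_add_Icc γ hab hbc (mem_univ b)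
    have h2 : eVariationOn γ (Icc b c) = 0 := eVariationOn.constant_on <| by
      rintro _ ⟨s, hs, rfl⟩ _ ⟨t, ht, rfl⟩
      rw [hconst s hs, hconst t ht]
    simpa [h2] using h1.symm
  rw [lineIntegral, lineIntegral, hV]
  refine setLIntegral_congr_fun measurableSet_Icc fun s hs => ?_
  rw [← image_variationOnFromTo h'] at hs
  obtain ⟨t, ht, rfl⟩ := hs
  have hvar : variationOnFromTo γ (Icc a b) a t = variationOnFromTo γ (Icc a c) a t := by
    rw [variationOnFromTo.eq_of_le _ _ ht.1, variationOnFromTo.eq_of_le _ _ ht.1,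
      inter_eq_right.2 (Icc_subset_Icc_right ht.2),
      inter_eq_right.2 (Icc_subset_Icc_right (ht.2.trans hbc))]
  rw [naturalParameterization_variationOnFromTo h' ht, hvar,
    naturalParameterization_variationOnFromTo h (hsub ht)]

theorem lineIntegral_mono {ρ σ : X → ℝ≥0∞} (h : ρ ≤ σ) (γ : ℝ → X) (a b : ℝ) :
    lineIntegral ρ γ a b ≤ lineIntegral σ γ a b :=
  lintegral_mono fun _ => h _

theorem rayIntegral_mono {ρ σ : X → ℝ≥0∞} (h : ρ ≤ σ) (γ : ℝ → X) :
    rayIntegral ρ γ ≤ rayIntegral σ γ :=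
  iSup_mono fun _ => lineIntegral_mono h _ _ _

theorem lineIntegral_const_mul {c : ℝ≥0∞} (hc : c ≠ ∞) (ρ : X → ℝ≥0∞) (γ : ℝ → X) (a b : ℝ) :
    lineIntegral (fun x => c * ρ x) γ a b = c * lineIntegral ρ γ a b :=
  lintegral_const_mul' _ _ hc

theorem rayIntegral_const_mul {c : ℝ≥0∞} (hc : c ≠ ∞) (ρ : X → ℝ≥0∞) (γ : ℝ → X) :
    rayIntegral (fun x => c * ρ x) γ = c * rayIntegral ρ γ := by
  simp only [rayIntegral, lineIntegral_const_mul hc, ENNReal.mul_iSup]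

theorem IsLocallyRectifiableRay.isRectifiableCurve {γ : ℝ → X} (h : IsLocallyRectifiableRay γ)
    {T : ℝ} (hT : 0 ≤ T) : IsRectifiableCurve γ 0 T := by
  refine ⟨hT, h.continuousOn.mono Icc_subset_Ici_self, ?_⟩
  have := h.rectifiable 0 T self_mem_Ici hT
  rwa [inter_eq_right.2 Icc_subset_Ici_self] at this

/-- A curve of length less than r from the centre cannot leave the ball; half of the gap r - d(x, y)
serves as slack. -/
theorem IsLengthSpace.isPreconnected_ball (h : IsLengthSpace X) (x : X) (r : ℝ) :
    IsPreconnected (Metric.ball x r) := by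
  refine isPreconnected_of_forall x fun y hy => ?_
  obtain ⟨γ, hγ, h0, h1, hlen⟩ := h x y ((r - dist x y) / 2)
    (by rw [Metric.mem_ball'] at hy; linarith)
  refine ⟨γ '' Icc 0 1, ?_, ⟨0, by simp, h0⟩, ⟨1, by simp, h1⟩, isPreconnected_Icc.image γ hγ⟩
  rintro _ ⟨t, ht, rfl⟩
  rw [Metric.mem_ball'] at hy ⊢
  have h2 := (eVariationOn.edist_le γ (left_mem_Icc.2 zero_le_one) ht).trans hlen
  rw [h0, edist_dist, ENNReal.ofReal_le_ofReal_iff (by linarith [dist_nonneg (x := x) (y := y)])]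
    at h2
  linarith

end Curves

/-! ### The potential: measurability, upper gradients, growth toward the end -/

section Potential

variable {X : Type*} [MetricSpace X]

/-- The infimum of `∫_γ σ ds` over the curves from `K` to `x`. -/
noncomputable def potential (σ : X → ℝ≥0∞) (K : Set X) (x : X) : ℝ≥0∞ :=
  ⨅ y ∈ K, weightedDist σ y x

theorem potential_eq_zero (σ : X → ℝ≥0∞) {K : Set X} {x : X} (hx : x ∈ K) :
    potential σ K x = 0 :=
  le_antisymm ((iInf₂_le x hx).trans_eq (weightedDist_self σ x)) bot_le

theorem potential_le_add (σ : X → ℝ≥0∞) (K : Set X) (x y : X) :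
    potential σ K y ≤ potential σ K x + weightedDist σ x y := by
  simp only [potential, ENNReal.iInf_add]
  exact le_iInf₂ fun z hz => (iInf₂_le z hz).trans (weightedDist_triangle σ z x y)

theorem potential_lt_iff {σ : X → ℝ≥0∞} {K : Set X} {x : X} {s : ℝ≥0∞} :
    potential σ K x < s ↔ ∃ (L : ℝ) (c : ℝ → X), 0 ≤ L ∧ LipschitzOnWith 1 c (Icc 0 L) ∧
      c 0 ∈ K ∧ c L = x ∧ ∫⁻ t in Icc 0 L, σ (c t) < s := by
  simp only [potential, iInf_lt_iff, weightedDist, sInf_lt_iff]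
  constructor
  · rintro ⟨y, hy, _, ⟨L, c, hL, hc, rfl, h1, rfl⟩, h2⟩
    exact ⟨L, c, hL, hc, hy, h1, h2⟩
  · rintro ⟨L, c, hL, hc, hy, h1, h2⟩
    exact ⟨c 0, hy, _, ⟨L, c, hL, hc, rfl, h1, rfl⟩, h2⟩

open scoped BoundedContinuousFunction in
/-- Pairs of a stopping time in `[0, M]` and a `1`-Lipschitz curve on `[0, M]` starting in `K`,
with cost at most `q` up to the stopping time. -/
def stoppedCurves (σ : X → ℝ≥0∞) (K : Set X) (M : ℕ) (q : ℝ≥0∞) :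
    Set (Icc (0 : ℝ) M × (Icc (0 : ℝ) M →ᵇ X)) :=
  {z | (LipschitzWith 1 z.2 ∧ z.2 ⟨0, le_rfl, M.cast_nonneg⟩ ∈ K) ∧
    ∫⁻ t, (Ico 0 (z.1 : ℝ)).indicator
      (fun t => σ (z.2 (projIcc 0 (M : ℝ) M.cast_nonneg t))) t ≤ q}

/-- Arzelà–Ascoli: by time M such curves stay in the closed M-neighbourhood of K, compact by
properness. -/
theorem isCompact_lipschitz_curves [ProperSpace X] {K : Set X} (hK : IsCompact K) (M : ℕ) :
    IsCompact {f : BoundedContinuousFunction (Icc (0 : ℝ) M) X |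
      LipschitzWith 1 f ∧ f ⟨0, le_rfl, M.cast_nonneg⟩ ∈ K} := by
  refine BoundedContinuousFunction.arzela_ascoli₂ (Metric.cthickening M K) hK.cthickening _ ?_ ?_ ?_
  · rw [ofPred_and]
    refine IsClosed.inter ?_ ?_
    · simp only [LipschitzWith, ofPred_forall]
      refine isClosed_iInter fun s => isClosed_iInter fun t => ?_
      exact isClosed_le ((continuous_eval_const s).edist (continuous_eval_const t)) continuous_const
    · exact hK.isClosed.preimage (continuous_eval_const _)
  · rintro f t ⟨hf, h0⟩
    refine Metric.mem_cthickening_of_dist_le _ _ _ _ h0 ((hf.dist_le_mul _ _).trans ?_)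
    rw [NNReal.coe_one, one_mul, Subtype.dist_eq, Real.dist_eq, sub_zero, abs_of_nonneg t.2.1]
    exact t.2.2
  · refine (LipschitzWith.uniformEquicontinuous _ 1 fun f => ?_).equicontinuous
    exact f.2.1

theorem isCompact_stoppedCurves [ProperSpace X] [MeasurableSpace X] [BorelSpace X]
    {σ : X → ℝ≥0∞} (hσ : LowerSemicontinuous σ) {K : Set X} (hK : IsCompact K) (M : ℕ)
    (q : ℝ≥0∞) : IsCompact (stoppedCurves σ K M q) := by
  have hcomp := (isCompact_univ (X := Icc (0 : ℝ) M)).prod (isCompact_lipschitz_curves hK M)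
  have hsplit : stoppedCurves σ K M q = ((univ : Set (Icc (0 : ℝ) M)) ×ˢ
      {f : BoundedContinuousFunction (Icc (0 : ℝ) M) X |
      LipschitzWith 1 f ∧ f ⟨0, le_rfl, M.cast_nonneg⟩ ∈ K}) ∩
      {z | ∫⁻ t, (Ico 0 (z.1 : ℝ)).indicator
        (fun t => σ (z.2 (projIcc 0 (M : ℝ) M.cast_nonneg t))) t ≤ q} := by
    ext z
    simp [stoppedCurves]
  rw [hsplit]
  refine hcomp.inter_right (IsSeqClosed.isClosed ?_)
  intro z w hz hzw
  have hL : Tendsto (fun n => ((z n).1 : ℝ)) atTop (𝓝 (w.1 : ℝ)) :=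
    (continuous_subtype_val.tendsto _).comp ((continuous_fst.tendsto _).comp hzw)
  have hf : ∀ t, Tendsto (fun n => (z n).2 t) atTop (𝓝 (w.2 t)) := fun t =>
    (continuous_eval_const t).continuousAt.tendsto.comp
      ((continuous_snd.tendsto _).comp hzw)
  -- The half-open interval matters: t < lim Lₙ forces t < Lₙ eventually, which fails for t = lim
  -- Lₙ. With lower semicontinuity of σ this feeds Fatou's lemma.
  have hpt : ∀ t, (Ico 0 (w.1 : ℝ)).indicator
        (fun t => σ (w.2 (projIcc 0 (M : ℝ) M.cast_nonneg t))) t ≤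
      liminf (fun n => (Ico 0 ((z n).1 : ℝ)).indicator
        (fun t => σ ((z n).2 (projIcc 0 (M : ℝ) M.cast_nonneg t))) t) atTop := by
    intro t
    by_cases ht : t ∈ Ico 0 (w.1 : ℝ)
    · rw [indicator_of_mem ht]
      refine le_of_forall_lt fun r hr => ?_
      obtain ⟨r', hr, hr'⟩ := exists_between hr
      refine hr.trans_le (le_liminf_of_le (by isBoundedDefault) ?_)
      filter_upwards [(hf _).eventually (hσ _ r' hr'), hL.eventually (lt_mem_nhds ht.2)]
        with n h1 h2
      rw [indicator_of_mem (show t ∈ Ico 0 ((z n).1 : ℝ) from ⟨ht.1, h2⟩)]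
      exact h1.le
    · rw [indicator_of_notMem ht]
      exact bot_le
  calc _ ≤ ∫⁻ t, liminf (fun n => (Ico 0 ((z n).1 : ℝ)).indicator
        (fun t => σ ((z n).2 (projIcc 0 (M : ℝ) M.cast_nonneg t))) t) atTop := lintegral_mono hpt
    _ ≤ liminf (fun n => ∫⁻ t, (Ico 0 ((z n).1 : ℝ)).indicator
        (fun t => σ ((z n).2 (projIcc 0 (M : ℝ) M.cast_nonneg t))) t) atTop := by
        refine lintegral_liminf_le fun n => Measurable.indicator ?_ measurableSet_Ico
        exact hσ.measurable.comp ((z n).2.continuous.comp continuous_projIcc).measurable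
    _ ≤ liminf (fun _ => q) atTop := liminf_le_liminf (Eventually.of_forall hz)
    _ = q := liminf_const q

/-- Exhibits the sublevel sets as countable unions of compact images: M bounds the duration, and a
rational q separates the cost from s. -/
theorem setOf_potential_lt_eq {σ : X → ℝ≥0∞} {K : Set X} {s : ℝ≥0∞} :
    {x | potential σ K x < s} = ⋃ (M : ℕ) (q : ℚ) (_ : (Real.toNNReal q : ℝ≥0∞) < s),
      (fun z : Icc (0 : ℝ) M × BoundedContinuousFunction (Icc (0 : ℝ) M) X => z.2 z.1) ''
        stoppedCurves σ K M (Real.toNNReal q : ℝ≥0∞) := by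
  ext x
  simp only [mem_ofPred_eq, potential_lt_iff, mem_iUnion]
  constructor
  · rintro ⟨L, c, hL, hc, h0, rfl, hlt⟩
    obtain ⟨q, -, hq, hqs⟩ := ENNReal.lt_iff_exists_rat_btwn.1 hlt
    obtain ⟨M, hM⟩ := exists_nat_ge L
    have hlip : LipschitzWith 1 fun t : Icc (0 : ℝ) M => c (projIcc 0 L hL t) := by
      intro s t
      refine (hc (projIcc 0 L hL s).2 (projIcc 0 L hL t).2).trans ?_
      gcongr
      simpa [Subtype.edist_eq] using LipschitzWith.projIcc hL (s : ℝ) t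
    refine ⟨M, q, hqs, ⟨⟨L, hL, hM⟩, BoundedContinuousFunction.mkOfCompact ⟨_, hlip.continuous⟩⟩,
      ⟨⟨hlip, ?_⟩, ?_⟩, ?_⟩
    · simpa [projIcc_of_le_left] using h0
    · refine le_trans (le_of_eq ?_) hq.le
      rw [lintegral_indicator measurableSet_Ico, restrict_Ico_eq_restrict_Icc]
      refine setLIntegral_congr_fun measurableSet_Icc fun t ht => ?_
      have h1 : projIcc 0 (M : ℝ) M.cast_nonneg t = ⟨t, ht.1, ht.2.trans hM⟩ :=
        projIcc_of_mem _ ⟨ht.1, ht.2.trans hM⟩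
      simp only [h1, BoundedContinuousFunction.mkOfCompact_apply, ContinuousMap.coe_mk,
        projIcc_of_mem hL ht]
    · simp
  · rintro ⟨M, q, hqs, ⟨L, f⟩, ⟨⟨hf, h0⟩, hcost⟩, rfl⟩
    refine ⟨L, fun t => f (projIcc 0 (M : ℝ) M.cast_nonneg t), L.2.1, ?_, ?_, by simp, ?_⟩
    · have := hf.comp (LipschitzWith.projIcc (M.cast_nonneg : (0 : ℝ) ≤ M))
      rw [mul_one] at this
      exact this.lipschitzOnWith
    · simpa [projIcc_of_le_left] using h0
    · refine lt_of_le_of_lt (le_trans (le_of_eq ?_) hcost) hqs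
      rw [lintegral_indicator measurableSet_Ico, restrict_Ico_eq_restrict_Icc]

theorem measurable_potential [ProperSpace X] [MeasurableSpace X] [BorelSpace X]
    {σ : X → ℝ≥0∞} (hσ : LowerSemicontinuous σ) {K : Set X} (hK : IsCompact K) :
    Measurable (potential σ K) := by
  refine measurable_of_Iio fun s => ?_
  change MeasurableSet {x | potential σ K x < s}
  rw [setOf_potential_lt_eq]
  refine .iUnion fun M => .iUnion fun q => .iUnion fun _ => IsCompact.measurableSet ?_
  refine (isCompact_stoppedCurves hσ hK M _).image ?_
  exact continuous_snd.eval continuous_fst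

theorem potential_le_add_lineIntegral (σ : X → ℝ≥0∞) (K : Set X) {γ : ℝ → X} {a b : ℝ}
    (h : IsRectifiableCurve γ a b) :
    potential σ K (γ b) ≤ potential σ K (γ a) + lineIntegral σ γ a b ∧
      potential σ K (γ a) ≤ potential σ K (γ b) + lineIntegral σ γ a b := by
  have hd := weightedDist_le_lineIntegral σ h
  refine ⟨(potential_le_add σ K (γ a) (γ b)).trans (by gcongr),
    (potential_le_add σ K (γ b) (γ a)).trans ?_⟩
  rw [weightedDist_comm]
  gcongr

/-- Sending ∞ to 0 does no harm: the potential is finite at both ends of a curve of finite σ-length,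
or at neither. -/
theorem isUpperGradient_toReal_potential [MeasurableSpace X] {σ : X → ℝ≥0∞} (hσ : Measurable σ)
    (K : Set X) : IsUpperGradient (fun x => (potential σ K x).toReal) σ := by
  refine ⟨hσ, fun γ a b h => ?_⟩
  obtain ⟨h1, h2⟩ := potential_le_add_lineIntegral σ K h
  rcases eq_or_ne (lineIntegral σ γ a b) ∞ with hI | hI
  · rw [hI]; exact le_top
  by_cases ha : potential σ K (γ a) = ∞
  · have hb : potential σ K (γ b) = ∞ := by
      by_contra hb
      rw [ha, top_le_iff] at h2
      exact ENNReal.add_ne_top.2 ⟨hb, hI⟩ h2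
    simp [ha, hb]
  · have hb : potential σ K (γ b) ≠ ∞ := fun hb => by
      rw [hb, top_le_iff] at h1
      exact ENNReal.add_ne_top.2 ⟨ha, hI⟩ h1
    have h1' := ENNReal.toReal_mono (ENNReal.add_ne_top.2 ⟨ha, hI⟩) h1
    have h2' := ENNReal.toReal_mono (ENNReal.add_ne_top.2 ⟨hb, hI⟩) h2
    rw [ENNReal.toReal_add ha hI] at h1'
    rw [ENNReal.toReal_add hb hI] at h2'
    rw [← ofReal_norm, ← ENNReal.ofReal_toReal hI]
    refine ENNReal.ofReal_le_ofReal ?_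
    rw [Real.norm_eq_abs, abs_le]
    constructor <;> linarith

theorem isUpperGradient_indicator_potential_eq_top [MeasurableSpace X] {σ : X → ℝ≥0∞}
    (hσ : Measurable σ) (K : Set X) {ε : ℝ≥0∞} (h0 : ε ≠ 0) (hε : ε ≠ ∞) :
    IsUpperGradient ({x | potential σ K x = ∞}.indicator fun _ => (1 : ℝ))
      (fun x => ε * σ x) := by
  refine ⟨hσ.const_mul ε, fun γ a b h => ?_⟩
  obtain ⟨h1, h2⟩ := potential_le_add_lineIntegral σ K h
  rw [lineIntegral_const_mul hε]
  rcases eq_or_ne (lineIntegral σ γ a b) ∞ with hI | hI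
  · rw [hI, ENNReal.mul_top h0]; exact le_top
  have hiff : potential σ K (γ b) = ∞ ↔ potential σ K (γ a) = ∞ := by
    constructor <;> intro h
    · rw [h, top_le_iff, ENNReal.add_eq_top] at h1
      exact h1.resolve_right hI
    · rw [h, top_le_iff, ENNReal.add_eq_top] at h2
      exact h2.resolve_right hI
  simp [indicator, hiff]

/-- If the curves from `K` toward `F` have `σ`-length at least `t`, then the potential is at least
`t` on `F`. -/
theorem le_potential {σ : X → ℝ≥0∞} {K F : Set X} {t : ℝ≥0∞}
    (h : ∀ γ ∈ curvesToward K F, t ≤ rayIntegral σ γ) {x : X} (hx : x ∈ F) :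
    t ≤ potential σ K x := by
  by_contra! hlt
  obtain ⟨L, c, hL, hc, h0, rfl, hcost⟩ := potential_lt_iff.1 hlt
  -- A cheap curve ending in F, made to stand still at its endpoint, is a ray toward F.
  set γ : ℝ → X := fun r => c (projIcc 0 L hL r) with hγ
  have hlip : LipschitzWith 1 γ := by
    intro s r
    refine (hc (projIcc 0 L hL s).2 (projIcc 0 L hL r).2).trans ?_
    gcongr
    simpa [Subtype.edist_eq] using LipschitzWith.projIcc hL s r
  have hconst : ∀ r, L ≤ r → γ r = c L := fun r hr => by simp [hγ, projIcc_of_right_le hL hr]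
  refine hcost.not_ge ((h γ ⟨⟨hlip.continuous.continuousOn, hlip.locallyBoundedVariationOn _⟩,
    ?_, L + 1, by linarith, ?_⟩).trans ?_)
  · simpa [hγ, projIcc_of_le_left] using h0
  · rintro _ ⟨r, hr, rfl⟩
    rw [hconst r (by linarith [mem_Ioi.1 hr])]
    exact hx
  · refine iSup_le fun T => ?_
    have hle : ∀ T : ℝ, 0 ≤ T → T ≤ L → lineIntegral σ γ 0 T ≤ ∫⁻ r in Icc 0 L, σ (c r) := by
      intro T hT hTL
      refine (lineIntegral_le_setLIntegral σ hT hlip.lipschitzOnWith).trans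
        ((lintegral_mono_set (Icc_subset_Icc_right hTL)).trans_eq ?_)
      exact setLIntegral_congr_fun measurableSet_Icc fun r hr => by
        simp only [hγ, projIcc_of_mem hL hr]
    rcases le_total (T : ℝ) L with hTL | hTL
    · exact hle T T.coe_nonneg hTL
    · rw [lineIntegral_eq_of_eqOn_const σ (isRectifiableCurve_of_lipschitzOnWith T.coe_nonneg
        hlip.lipschitzOnWith) hL hTL fun r hr => (hconst r hr.1).trans (hconst L le_rfl).symm]
      exact hle L hL le_rfl

end Potential

/-! ### Parabolic ends and exceptional sets -/

section Ends

variable {X : Type*} [MetricSpace X]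

theorem curvesToward_mono {K F F' : Set X} (h : F ⊆ F') : curvesToward K F ⊆ curvesToward K F' := by
  rintro γ ⟨h1, h2, τ, hτ, h3⟩
  exact ⟨h1, h2, τ, hτ, h3.trans h⟩

theorem IsEnd.antitone {F K : ℕ → Set X} (h : IsEnd F K) : Antitone F :=
  antitone_nat_of_succ_le fun j => subset_closure.trans (h.closure_subset j)

variable [MeasurableSpace X]

theorem modulus_mono (μ : Measure X) (p : ℝ) {Γ Γ' : Set (ℝ → X)} (h : Γ ⊆ Γ') :
    modulus μ p Γ ≤ modulus μ p Γ' :=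
  le_iInf fun ρ => le_iInf fun hρ => le_iInf fun hΓ =>
    iInf_le_of_le ρ <| iInf_le_of_le hρ <| iInf_le_of_le (fun γ hγ => hΓ γ (h hγ)) le_rfl

theorem IsParabolicEnd.iInf_modulus_eq_zero {μ : Measure X} {p : ℝ} {F K : ℕ → Set X}
    (hend : IsEnd F K) (hpar : IsParabolicEnd μ p F K) :
    ⨅ j, modulus μ p (curvesToward (K 0) (F j)) = 0 := by
  by_contra hne
  refine hpar ⟨_, pos_iff_ne_zero.2 hne, tendsto_atTop_iInf fun i j hij => ?_⟩
  exact modulus_mono μ p (curvesToward_mono (hend.antitone hij))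

theorem exists_lintegral_rpow_lt_of_modulus_lt {μ : Measure X} {p : ℝ} {Γ : Set (ℝ → X)}
    {t : ℝ≥0∞} (h : modulus μ p Γ < t) : ∃ ρ : X → ℝ≥0∞, Measurable ρ ∧
      (∀ γ ∈ Γ, 1 ≤ rayIntegral ρ γ) ∧ ∫⁻ x, ρ x ^ p ∂μ < t := by
  simp only [modulus, iInf_lt_iff] at h
  obtain ⟨ρ, h1, h2, h3⟩ := h
  exact ⟨ρ, h1, h2, h3⟩

/-- A parabolic end is infinitely far away for some lower semicontinuous density in `L^p`. -/
theorem exists_weight_of_isParabolicEnd [BorelSpace X] {μ : Measure X} [μ.WeaklyRegular]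
    {p : ℝ} (hp : 1 ≤ p) {F K : ℕ → Set X} (hend : IsEnd F K)
    (hpar : IsParabolicEnd μ p F K) :
    ∃ σ : X → ℝ≥0∞, LowerSemicontinuous σ ∧ ∫⁻ x, σ x ^ p ∂μ < ∞ ∧
      ∀ j : ℕ, ∃ k, ∀ γ ∈ curvesToward (K 0) (F k), 2 ^ j ≤ rayIntegral σ γ := by
  have hp0 : 0 < p := one_pos.trans_le hp
  have hex : ∀ j : ℕ, ∃ (k : ℕ) (ρ : X → ℝ≥0∞), Measurable ρ ∧
      (∀ γ ∈ curvesToward (K 0) (F k), 1 ≤ rayIntegral ρ γ) ∧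
      ∫⁻ x, ((2 : ℝ≥0∞) ^ j * ρ x) ^ p ∂μ ≤ 2⁻¹ ^ j := by
    intro j
    have htop : ((2 : ℝ≥0∞) ^ j) ^ p ≠ ∞ :=
      ENNReal.rpow_ne_top_of_nonneg hp0.le (ENNReal.pow_ne_top ENNReal.ofNat_ne_top)
    -- The threshold absorbs the factor (2^j)^p and leaves the summable bound 2^{-j}.
    have hpos : (0 : ℝ≥0∞) < 2⁻¹ ^ j / (2 ^ j) ^ p :=
      ENNReal.div_pos (pow_ne_zero _ (by simp)) htop
    rw [← hpar.iInf_modulus_eq_zero hend, iInf_lt_iff] at hpos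
    obtain ⟨k, hk⟩ := hpos
    obtain ⟨ρ, hρ, hΓ, hlt⟩ := exists_lintegral_rpow_lt_of_modulus_lt hk
    refine ⟨k, ρ, hρ, hΓ, ?_⟩
    simp only [ENNReal.mul_rpow_of_nonneg _ _ hp0.le]
    rw [lintegral_const_mul' _ _ htop]
    refine (mul_le_mul_right hlt.le _).trans ENNReal.mul_div_le
  choose k ρ hρ hΓ hint using hex
  have hmeas : ∀ j, Measurable fun x => ((2 : ℝ≥0∞) ^ j * ρ j x) ^ p := fun j =>
    ((hρ j).const_mul _).pow_const p
  -- Summing p-th powers avoids Minkowski's inequality; the p-th root of g still dominates each 2^j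
  -- ρⱼ.
  obtain ⟨g, hle, hlsc, hg⟩ := exists_le_lowerSemicontinuous_lintegral_ge μ
    (fun x => ∑' j, ((2 : ℝ≥0∞) ^ j * ρ j x) ^ p) (.tsum hmeas) one_ne_zero
  refine ⟨fun x => g x ^ p⁻¹, ?_, ?_, fun j => ⟨k j, fun γ hγ => ?_⟩⟩
  · exact (ENNReal.continuous_rpow_const).comp_lowerSemicontinuous hlsc
      (ENNReal.monotone_rpow_of_nonneg (inv_nonneg.2 hp0.le))
  · simp only [ENNReal.rpow_inv_rpow hp0.ne']
    refine hg.trans_lt (ENNReal.add_lt_top.2 ⟨?_, ENNReal.one_lt_top⟩)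
    rw [lintegral_tsum fun j => (hmeas j).aemeasurable]
    refine (ENNReal.tsum_le_tsum hint).trans_lt ?_
    rw [ENNReal.tsum_geometric]
    simp
  · calc (2 : ℝ≥0∞) ^ j ≤ 2 ^ j * rayIntegral (ρ j) γ := le_mul_of_one_le_right' (hΓ j γ hγ)
      _ = rayIntegral (fun x => 2 ^ j * ρ j x) γ :=
        (rayIntegral_const_mul (ENNReal.pow_ne_top ENNReal.ofNat_ne_top) _ _).symm
      _ ≤ _ := rayIntegral_mono (fun x => ?_) γ
    rw [ENNReal.le_rpow_inv_iff hp0]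
    exact (ENNReal.le_tsum j).trans (hle x)

/-- If almost every point has infinite potential, then `K` is `p`-exceptional. -/
theorem isExceptional_of_potential_eq_top {μ : Measure X} {p : ℝ} (hp : 0 < p) {σ : X → ℝ≥0∞}
    (hσ : Measurable σ) (hint : ∫⁻ x, σ x ^ p ∂μ < ∞) {K : Set X}
    (hU : Measurable (potential σ K)) (hnull : μ {x | potential σ K x = ∞}ᶜ = 0) :
    IsExceptional μ p K := by
  set A := {x | potential σ K x = ∞} with hA
  have hAm : MeasurableSet A := hU (measurableSet_singleton ∞)
  set h : X → ℝ≥0∞ := fun x => σ x + Aᶜ.indicator (fun _ => ∞) x with hh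
  have hm : Measurable h := hσ.add (measurable_const.indicator hAm.compl)
  have hhint : ∫⁻ x, h x ^ p ∂μ = ∫⁻ x, σ x ^ p ∂μ := by
    refine lintegral_congr_ae ?_
    filter_upwards [compl_mem_ae_iff.2 hnull] with x hx
    simp [hh, indicator_of_notMem hx]
  have hray : ∀ γ, IsLocallyRectifiableRay γ → (γ '' Ici 0).Nontrivial →
      ((γ '' Ici 0) ∩ K).Nonempty → rayIntegral h γ = ∞ := by
    rintro γ hγ hnt ⟨_, ⟨s, hs, rfl⟩, hsK⟩
    obtain ⟨_, ⟨t, ht, rfl⟩, hne⟩ := hnt.exists_ne (γ s)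
    rw [mem_Ici] at hs ht
    -- This subcurve contains a point of K and a different point, so its length is positive.
    have hT : 0 ≤ max s t := hs.trans (le_max_left _ _)
    have hr := hγ.isRectifiableCurve hT
    have hsI : s ∈ Icc 0 (max s t) := ⟨hs, le_max_left _ _⟩
    have htI : t ∈ Icc 0 (max s t) := ⟨ht, le_max_right _ _⟩
    have hV : 0 < (eVariationOn γ (Icc 0 (max s t))).toReal := by
      refine ENNReal.toReal_pos (fun h0 => hne ?_) hr.rectifiable
      exact edist_eq_zero.1 (le_antisymm (h0 ▸ eVariationOn.edist_le γ htI hsI) bot_le)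
    refine top_le_iff.1 (le_trans ?_ (le_iSup _ (⟨max s t, hT⟩ : ℝ≥0)))
    change ∞ ≤ lineIntegral h γ 0 (max s t)
    rcases eq_or_ne (lineIntegral σ γ 0 (max s t)) ∞ with hI | hI
    · rw [← hI]
      exact lineIntegral_mono (fun x => le_self_add) _ _ _
    · have hmem : ∀ r ∈ Icc 0 (eVariationOn γ (Icc 0 (max s t))).toReal,
          naturalParameterization γ (Icc 0 (max s t)) 0 r ∈ Aᶜ := by
        intro r hr' htop
        have h1 := potential_le_add σ K (γ s) (naturalParameterization γ (Icc 0 (max s t)) 0 r)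
        have h2 := weightedDist_naturalParameterization_le σ hr hsI hr'
        rw [potential_eq_zero σ hsK, zero_add, htop, top_le_iff] at h1
        rw [h1, top_le_iff] at h2
        exact hI h2
      calc (∞ : ℝ≥0∞) = ∫⁻ _ in Icc 0 (eVariationOn γ (Icc 0 (max s t))).toReal, ∞ := by
            rw [setLIntegral_const, Real.volume_Icc, ENNReal.top_mul]
            simpa using hV
        _ ≤ _ := setLIntegral_mono' measurableSet_Icc fun r hr' => by
            simp [hh, indicator_of_mem (hmem r hr')]
  have hbound : ∀ ε : ℝ≥0, 0 < ε → modulus μ p {γ | IsLocallyRectifiableRay γ ∧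
      (γ '' Ici 0).Nontrivial ∧ ((γ '' Ici 0) ∩ K).Nonempty} ≤
      (ε : ℝ≥0∞) ^ p * ∫⁻ x, σ x ^ p ∂μ := by
    intro ε hε
    refine iInf_le_of_le (fun x => ε * h x) <| iInf_le_of_le (hm.const_mul _) <|
      iInf_le_of_le ?_ (le_of_eq ?_)
    · rintro γ ⟨h1, h2, h3⟩
      rw [rayIntegral_const_mul ENNReal.coe_ne_top, hray γ h1 h2 h3,
        ENNReal.mul_top (by simpa using hε.ne')]
      exact le_top
    · simp only [ENNReal.mul_rpow_of_nonneg _ _ hp.le]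
      rw [lintegral_const_mul' _ _ (ENNReal.rpow_ne_top_of_nonneg hp.le ENNReal.coe_ne_top), hhint]
  refine le_antisymm (ge_of_tendsto (f := fun ε : ℝ≥0 => (ε : ℝ≥0∞) ^ p * ∫⁻ x, σ x ^ p ∂μ)
    (x := 𝓝[>] 0) ?_ (eventually_mem_nhdsWithin.mono hbound)) bot_le
  have : Tendsto (fun ε : ℝ≥0 => (ε : ℝ≥0∞) ^ p * ∫⁻ x, σ x ^ p ∂μ) (𝓝 0)
      (𝓝 (((0 : ℝ≥0) : ℝ≥0∞) ^ p * ∫⁻ x, σ x ^ p ∂μ)) :=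
    ENNReal.Tendsto.mul_const
      ((ENNReal.continuous_rpow_const.comp ENNReal.continuous_coe).tendsto 0) (Or.inr hint.ne)
  rw [ENNReal.coe_zero, ENNReal.zero_rpow_of_pos hp, zero_mul] at this
  exact this.mono_left nhdsWithin_le_nhds

/-! ### The set of infinite potential is null or conull -/

theorem measure_inter_ball_eq_zero_or [BorelSpace X] {μ : Measure X} {p : ℝ} (hp : 0 < p)
    [IsLocallyFiniteMeasure μ]
    (hball : ∀ (x : X) (r : ℝ), 0 < r → 0 < μ (Metric.ball x r) ∧ μ (Metric.ball x r) < ∞)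
    {σ : X → ℝ≥0∞} (hσ : Measurable σ) (hint : ∫⁻ x, σ x ^ p ∂μ < ∞) {K : Set X}
    (hU : Measurable (potential σ K)) {x : X} {r C lam : ℝ} (hr : 0 < r) (hlam : 0 < lam)
    (hPI : ∀ (u : X → ℝ) (g : X → ℝ≥0∞), LocallyIntegrable u μ → IsUpperGradient u g →
        ⨍⁻ y in Metric.ball x r, ‖u y - ⨍ z in Metric.ball x r, u z ∂μ‖ₑ ∂μ ≤
          ENNReal.ofReal (C * r) * (⨍⁻ y in Metric.ball x (lam * r), g y ^ p ∂μ) ^ (1 / p)) :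
    μ ({x | potential σ K x = ∞} ∩ Metric.ball x r) = 0 ∨
      μ ({x | potential σ K x = ∞}ᶜ ∩ Metric.ball x r) = 0 := by
  set A := {x | potential σ K x = ∞} with hA
  have hAm : MeasurableSet A := hU (measurableSet_singleton ∞)
  set u : X → ℝ := A.indicator fun _ => (1 : ℝ) with hu
  have hum : Measurable u := measurable_const.indicator hAm
  set m := ⨍ z in Metric.ball x r, u z ∂μ with hm
  set D : ℝ≥0∞ := ENNReal.ofReal (C * r) *
    (⨍⁻ y in Metric.ball x (lam * r), σ y ^ p ∂μ) ^ (1 / p) with hD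
  have hDtop : D ≠ ∞ := by
    refine ENNReal.mul_ne_top ENNReal.ofReal_ne_top
      (ENNReal.rpow_ne_top_of_nonneg (by positivity) ?_)
    rw [setLAverage_eq]
    refine (ENNReal.div_lt_top ((setLIntegral_le_lintegral _ _).trans_lt hint).ne
      (hball x _ (mul_pos hlam hr)).1.ne').ne
  have hbound : ∀ ε : ℝ≥0, 0 < ε →
      ⨍⁻ y in Metric.ball x r, ‖u y - m‖ₑ ∂μ ≤ ε * D := by
    intro ε hε
    have := hPI u (fun x => ε * σ x) ((locallyIntegrable_const 1).indicator hAm)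
      (isUpperGradient_indicator_potential_eq_top hσ K (by simpa using hε.ne') ENNReal.coe_ne_top)
    refine this.trans_eq ?_
    simp only [ENNReal.mul_rpow_of_nonneg _ _ hp.le, setLAverage_eq]
    rw [lintegral_const_mul' _ _ (ENNReal.rpow_ne_top_of_nonneg hp.le ENNReal.coe_ne_top),
      mul_div_assoc, ENNReal.mul_rpow_of_nonneg _ _ (by positivity : 0 ≤ 1 / p), one_div,
      ENNReal.rpow_rpow_inv hp.ne', hD, one_div, setLAverage_eq, mul_left_comm]
  have hzero : ⨍⁻ y in Metric.ball x r, ‖u y - m‖ₑ ∂μ = 0 := by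
    refine le_antisymm (ge_of_tendsto (f := fun ε : ℝ≥0 => (ε : ℝ≥0∞) * D) (x := 𝓝[>] 0) ?_
      (eventually_mem_nhdsWithin.mono hbound)) bot_le
    have : Tendsto (fun ε : ℝ≥0 => (ε : ℝ≥0∞) * D) (𝓝 0) (𝓝 ((0 : ℝ≥0) * D)) :=
      ENNReal.Tendsto.mul_const (ENNReal.tendsto_coe.2 tendsto_id) (Or.inr hDtop)
    rw [ENNReal.coe_zero, zero_mul] at this
    exact this.mono_left nhdsWithin_le_nhds
  rw [setLAverage_eq, ENNReal.div_eq_zero_iff, or_iff_left (hball x r hr).2.ne,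
    lintegral_eq_zero_iff (hum.sub_const m).enorm] at hzero
  have hae : ∀ᵐ y ∂μ.restrict (Metric.ball x r), u y = m := by
    filter_upwards [hzero] with y hy
    simpa [sub_eq_zero] using hy
  rw [← Measure.restrict_apply hAm, ← Measure.restrict_apply hAm.compl]
  -- The indicator equals m a.e. on the ball: if m = 1 the complement is null there, otherwise the
  -- set is.
  by_cases h1 : m = 1
  · right
    refine measure_mono_null (fun y hy => ?_) hae
    simpa [hu, h1] using hy
  · left
    refine measure_mono_null (fun y hy => ?_) hae
    simpa [hu, indicator_of_mem hy] using Ne.symm h1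

/-- If y lies in the ball about x, the two r-balls overlap in positive measure, so they cannot be of
opposite types. The centres where A is null thus form a clopen set. -/
theorem null_or_conull_of_forall_ball [ConnectedSpace X] [SecondCountableTopology X]
    {μ : Measure X} (hball : ∀ (x : X) (r : ℝ), 0 < r → 0 < μ (Metric.ball x r)) {A : Set X}
    {r : ℝ} (hr : 0 < r)
    (h : ∀ x, μ (A ∩ Metric.ball x r) = 0 ∨ μ (Aᶜ ∩ Metric.ball x r) = 0) :
    μ A = 0 ∨ μ Aᶜ = 0 := by
  have hnear : ∀ x y, dist x y < r → μ (A ∩ Metric.ball x r) = 0 → μ (A ∩ Metric.ball y r) = 0 := by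
    intro x y hxy hx
    refine (h y).resolve_right fun hy => ?_
    obtain ⟨ε, hε, hsub⟩ := Metric.isOpen_iff.1 (Metric.isOpen_ball (x := x) (ε := r)) y
      (by rwa [Metric.mem_ball, dist_comm])
    refine (hball y (min ε r) (lt_min hε hr)).ne' (measure_mono_null (fun z hz => ?_)
      (measure_union_null hx hy))
    by_cases hzA : z ∈ A
    · exact Or.inl ⟨hzA, hsub (Metric.ball_subset_ball (min_le_left _ _) hz)⟩
    · exact Or.inr ⟨hzA, Metric.ball_subset_ball (min_le_right _ _) hz⟩
  have hclopen : IsClopen {x | μ (A ∩ Metric.ball x r) = 0} := by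
    refine ⟨⟨Metric.isOpen_iff.2 fun x hx => ⟨r, hr, fun y hy hy0 => hx ?_⟩⟩,
      Metric.isOpen_iff.2 fun x hx => ⟨r, hr, fun y hy => ?_⟩⟩
    · exact hnear y x hy hy0
    · exact hnear x y (by rwa [dist_comm]) hx
  rcases isClopen_iff.1 hclopen with h0 | h1
  · right
    refine measure_null_of_locally_null _ fun x _ => ⟨Aᶜ ∩ Metric.ball x r, ?_, ?_⟩
    · exact inter_mem self_mem_nhdsWithin (mem_nhdsWithin_of_mem_nhds (Metric.ball_mem_nhds x hr))
    · exact (h x).resolve_left fun hx =>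
        (h0 ▸ (hx : x ∈ {x | μ (A ∩ Metric.ball x r) = 0}) : x ∈ (∅ : Set X))
  · left
    refine measure_null_of_locally_null _ fun x _ => ⟨A ∩ Metric.ball x r, ?_, ?_⟩
    · exact inter_mem self_mem_nhdsWithin (mem_nhdsWithin_of_mem_nhds (Metric.ball_mem_nhds x hr))
    · have : x ∈ {x | μ (A ∩ Metric.ball x r) = 0} := h1 ▸ mem_univ x
      exact this

/-- Unit balls are connected, so those centred in F far from K stay in F. Unboundedness supplies
arbitrarily many disjoint ones, each of measure at least the infimum. -/
theorem measure_unbounded_component [OpensMeasurableSpace X] {μ : Measure X}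
    (hlength : IsLengthSpace X) (hinf : 0 < ⨅ x : X, μ (Metric.ball x 1)) {K F : Set X}
    (hK : Bornology.IsBounded K) (hF : ∃ x ∈ Kᶜ, F = connectedComponentIn Kᶜ x)
    (hunb : ¬ Bornology.IsBounded F) : μ F = ∞ := by
  obtain ⟨x₀, -, hFeq⟩ := hF
  obtain ⟨R₀, hR₀⟩ := hK.subset_ball x₀
  have hsub : ∀ x ∈ F, R₀ + 1 ≤ dist x x₀ → Metric.ball x 1 ⊆ F := by
    intro x hx hd
    rw [hFeq] at hx ⊢
    rw [connectedComponentIn_eq hx]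
    refine (hlength.isPreconnected_ball x 1).subset_connectedComponentIn
      (Metric.mem_ball_self one_pos) fun y hy hyK => ?_
    have h1 := Metric.mem_ball.1 (hR₀ hyK)
    have h2 := Metric.mem_ball'.1 hy
    linarith [dist_triangle x y x₀]
  have hfar : ∀ R, ∃ x ∈ F, R ≤ dist x x₀ := by
    intro R
    by_contra! h
    exact hunb (Metric.isBounded_ball.subset fun x hx => Metric.mem_ball.2 (h x hx))
  have key : ∀ n : ℕ, ∃ R, (n : ℝ≥0∞) * ⨅ x : X, μ (Metric.ball x 1) ≤ μ (F ∩ Metric.ball x₀ R) := by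
    intro n
    induction n with
    | zero => exact ⟨0, by simp⟩
    | succ n ih =>
      obtain ⟨R, hR⟩ := ih
      -- Distance R₀ + 1 keeps the new unit ball off K; R + 1 keeps it disjoint from the part
      -- already counted.
      obtain ⟨x, hx, hd⟩ := hfar (max (R₀ + 1) (R + 1))
      refine ⟨max R (dist x x₀ + 1), ?_⟩
      have hdisj : Disjoint (F ∩ Metric.ball x₀ R) (Metric.ball x 1) := by
        refine Disjoint.mono_left inter_subset_right ?_
        refine Metric.ball_disjoint_ball ?_
        rw [dist_comm]
        exact (le_max_right _ _).trans hd
      calc ((n + 1 : ℕ) : ℝ≥0∞) * ⨅ x : X, μ (Metric.ball x 1)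
          = n * (⨅ x : X, μ (Metric.ball x 1)) + ⨅ x : X, μ (Metric.ball x 1) := by
            push_cast; ring
        _ ≤ μ (F ∩ Metric.ball x₀ R) + μ (Metric.ball x 1) := add_le_add hR (iInf_le _ x)
        _ = μ (F ∩ Metric.ball x₀ R ∪ Metric.ball x 1) :=
            (measure_union hdisj Metric.isOpen_ball.measurableSet).symm
        _ ≤ _ := measure_mono <| by
            refine union_subset (inter_subset_inter_right _
              (Metric.ball_subset_ball (le_max_left _ _))) (subset_inter
              (hsub x hx ((le_max_left _ _).trans hd)) ?_)
            refine (Metric.ball_subset_ball' ?_).trans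
              (Metric.ball_subset_ball (le_max_right R (dist x x₀ + 1)))
            rw [add_comm]
  by_contra hne
  obtain ⟨n, hn⟩ := ENNReal.exists_nat_mul_gt hinf.ne' hne
  obtain ⟨R, hR⟩ := key n
  exact (hn.trans_le (hR.trans (measure_mono inter_subset_left))).false

end Ends

end NewtonSobolev

/-! ### The main theorem -/

open NewtonSobolev in
theorem mainTheorem6 {X : Type*} [MetricSpace X] [ProperSpace X] [ConnectedSpace X]
    [MeasurableSpace X] [BorelSpace X] (μ : Measure X) (p : ℝ) (hp : 1 ≤ p)
    (hμ : μ univ = ∞)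
    (hball : ∀ (x : X) (r : ℝ), 0 < r → 0 < μ (Metric.ball x r) ∧ μ (Metric.ball x r) < ∞)
    (hcontrolled : NewtonSobolev.UniformlyLocallyControlled μ p)
    (hlength : NewtonSobolev.IsLengthSpace X)
    (hinf : 0 < ⨅ x : X, μ (Metric.ball x 1))
    (F K : ℕ → Set X) (hend : NewtonSobolev.IsEnd F K)
    (hK : ¬ NewtonSobolev.IsExceptional μ p (K 0))
    (hparabolic : NewtonSobolev.IsParabolicEnd μ p F K) :
    NewtonSobolev.dirichletClass μ p ≠
      NewtonSobolev.newtonClass μ p + range (Function.const X : ℝ → X → ℝ) := by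
  have hp0 : 0 < p := one_pos.trans_le hp
  have : IsLocallyFiniteMeasure μ :=
    ⟨fun x => ⟨_, Metric.ball_mem_nhds x one_pos, (hball x 1 one_pos).2⟩⟩
  obtain ⟨σ, hlsc, hint, hfar⟩ := exists_weight_of_isParabolicEnd hp hend hparabolic
  have hσ := hlsc.measurable
  have hU := measurable_potential hlsc (hend.isCompact 0)
  have hfin : μ {x | potential σ (K 0) x = ∞} = 0 := by
    obtain ⟨R₀, Cd, C, lam, hR₀, -, -, hlam, hctl⟩ := hcontrolled
    obtain ⟨r, hr, hrR⟩ : ∃ r : ℝ, 0 < r ∧ ENNReal.ofReal r < R₀ := by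
      obtain ⟨q, hq0, hq⟩ := ENNReal.lt_iff_exists_nnreal_btwn.1 hR₀
      exact ⟨q, by simpa using hq0, by simpa using hq⟩
    refine (null_or_conull_of_forall_ball (fun x r hr => (hball x r hr).1) hr fun x =>
      measure_inter_ball_eq_zero_or hp0 hball hσ hint hU hr hlam
        (hctl x r hr hrR).2).resolve_right fun h => ?_
    exact hK (isExceptional_of_potential_eq_top hp0 hσ hint hU h)
  have hmem : (fun x => (potential σ (K 0) x).toReal) ∈ dirichletClass μ p :=
    ⟨hU.ennreal_toReal.aemeasurable, σ, isUpperGradient_toReal_potential hσ _, hint⟩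
  intro heq
  rw [heq] at hmem
  obtain ⟨v, ⟨⟨hvm, -⟩, hv⟩, _, ⟨c, rfl⟩, hvc⟩ := hmem
  -- Since 2^j ≥ j ≥ |c| + 1, the potential minus c is at least 1 wherever it is finite on `F k`.
  obtain ⟨j, hj⟩ := exists_nat_ge (|c| + 1)
  obtain ⟨k, hk⟩ := hfar j
  have hF := measure_unbounded_component hlength hinf (hend.isCompact k).isBounded
    (hend.component k) (hend.unbounded k)
  have hlarge : ∀ x ∈ F k, potential σ (K 0) x ≠ ∞ → 1 ≤ ‖v x‖ₑ := by
    intro x hx hxfin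
    have h1 : (2 : ℝ≥0∞) ^ j ≤ potential σ (K 0) x := le_potential hk hx
    have h2 : (2 : ℝ) ^ j ≤ (potential σ (K 0) x).toReal := by
      simpa using ENNReal.toReal_mono hxfin h1
    have h3 : (j : ℝ) ≤ 2 ^ j := by exact_mod_cast Nat.lt_two_pow_self.le
    have h4 : v x + c = (potential σ (K 0) x).toReal := congrFun hvc x
    have h5 : 1 ≤ v x := by linarith [le_abs_self c]
    rw [← ofReal_norm, Real.norm_eq_abs, ENNReal.one_le_ofReal]
    exact h5.trans (le_abs_self _)
  refine hv.not_ge ?_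
  calc (∞ : ℝ≥0∞) = μ (F k) := hF.symm
    _ ≤ μ {x | 1 ≤ ‖v x‖ₑ ^ p} := by
        refine measure_mono_ae ?_
        filter_upwards [compl_mem_ae_iff.2 hfin] with x hx hxF
        exact ENNReal.one_le_rpow (hlarge x hxF hx) hp0
    _ ≤ ∫⁻ x, ‖v x‖ₑ ^ p ∂μ :=
        meas_le_lintegral₀ (hvm.enorm.pow_const p) fun x hx => hx
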